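/- Let $M>1$, $\mathcal R=[1/M,M]$, $\widehat x\in\mathcal R$ and $\delta\in(0,1)$. Let $D=\{x\in\mathcal R:\ 1-\delta\le x/\widehat x\le 1+\delta\}$. Put $$\phi_3(t,x)=\frac{x/\widehat x-1}{2+(t+1)(x/\widehat x-1)},\qquad \operatorname{hyp}\log(\alpha)=\{(x,\nu)\in D\times\mathbb R:\ \log x\ge \nu-\alpha\},$$ and, with $t_1,\dots,t_N$ and $w_1,\dots,w_N$ the nodes and weights of the $N$-point Gauss–Legendre quadrature on $[-1,1]$, $$\widehat H_{\phi_3,N}=\Big\{(x,\nu)\in D\times\mathbb R:\ \exists v\in\mathbb R^N,\ \sum_{k=1}^N w_kv_k\ge \nu-\log\widehat x,\ \ v_k\le\phi_3(t_k,x)\ \text{ for all } k\Big\}.$$ Let $\mathcal L_3=\{y\in\mathbb R^3: y_3\ge\sqrt{y_1^2+y_2^2}\}$. A second-order cone (SOC) constraint on a vector of variables is the requirement that a given affine function of it with values in $\mathbb R^3$ take its value in $\mathcal L_3$; an affine inequality is counted as one SOC constraint. 1. Let $\rho=(2-\delta)/\delta$ and $L=\big((2-\delta)/\delta-\rho/2-\rho^{-1}/2\big)^{-1}$.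 Then $\rho>1$, $0<L<\infty$, and for all $x\in D$ and all $z=\frac{\rho}{2}e^{i\theta}+\frac{\rho^{-1}}{2}e^{-i\theta}$ with $\theta\in[0,2\pi]$, the denominator of $\phi_3(z,x)$ is nonzero and $|\phi_3(z,x)|\le L$. 2. For every integer $N\ge0$ there are exactly $N$ quadrature nodes, and $\widehat H_{\phi_3,N}$ is the set of all $(x,\nu)\in D\times\mathbb R$ for which there is $v\in\mathbb R^N$ with $\sum_{k}w_kv_k\ge\nu-\log\widehat x$ and, for all $k$, $$r_{1k}=1-(t_k+1)v_k\ge0,\quad r_{2k}=(x/\widehat x-1)-2v_k\ge0,\quad \big(v_k\sqrt{8(t_k+1)},\,r_{1k}-r_{2k},\,r_{1k}+r_{2k}\big)\in\mathcal L_3 .$$ Moreover $\widehat H_{\phi_3,N}$ is the projection onto two coordinates of the solution set of a system of $3N+5$ SOC constraints in $N+2$ variables. 3. There is an absolute constant $C>0$ such that for all $\delta\in(0,1)$ and $\epsilon>0$, with $$r(\delta,\epsilon)=\frac{\log(1-\delta)}{\log\delta}+\frac{\log\epsilon}{\log\delta},$$ there is an integer $N_0\ge1$ with $N_0\le\max\{1,\,C\,r(\delta,\epsilon)\}$,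 hence $N_0=O(r(\delta,\epsilon))$ up to the requirement that there be at least one point, such that for all $N\ge N_0$, all $M>1$ and all $\widehat x\in[1/M,M]$, $$\operatorname{hyp}\log(-\epsilon)\subseteq\widehat H_{\phi_3,N}\subseteq\operatorname{hyp}\log(\epsilon),$$ and the total number $(N_0+2)+(3N_0+5)$ of variables and SOC constraints in the representation of $\widehat H_{\phi_3,N_0}$ is at most $C\max\{1,r(\delta,\epsilon)\}$. -/

import Mathlib

open Set

noncomputable section

namespace LogSOC

/-- The Lorentz cone `𝓛_{q+1} = {y ∈ ℝ^{q+1} : y_{q+1} ≥ √(∑_{i ≤ q} y_i²)}`. -/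
def lorentzCone (q : ℕ) : Set (Fin (q + 1) → ℝ) :=
  {y | Real.sqrt (∑ i : Fin q, y i.castSucc ^ 2) ≤ y (Fin.last q)}

/-- Data of a system of `m` second-order cone constraints
`(a_{i1}ᵀ y + b_{i1}, a_{i2}ᵀ y + b_{i2}, a_{i3}ᵀ y + b_{i3}) ∈ 𝓛_3` in `n` variables. -/
structure SOCSystem (n m : ℕ) where
  A₁ : Matrix (Fin m) (Fin n) ℝ
  A₂ : Matrix (Fin m) (Fin n) ℝ
  A₃ : Matrix (Fin m) (Fin n) ℝ
  b₁ : Fin m → ℝ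
  b₂ : Fin m → ℝ
  b₃ : Fin m → ℝ

/-- The solution set of a system of second-order cone constraints. -/
def SOCSystem.feasible {n m : ℕ} (K : SOCSystem n m) : Set (Fin n → ℝ) :=
  {y | ∀ i : Fin m,
    ![(K.A₁.mulVec y + K.b₁) i, (K.A₂.mulVec y + K.b₂) i, (K.A₃.mulVec y + K.b₃) i]
      ∈ lorentzCone 2}

/-- `S ⊆ ℝ²` is the projection, onto two of the variables, of the solution set of a system of `m`
second-order cone constraints in `n` variables (the two projected variables are counted in `n`). -/
def HasSOCRepresentation (S : Set (ℝ × ℝ)) (n m : ℕ) : Prop :=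
  ∃ (K : SOCSystem n m) (i j : Fin n), i ≠ j ∧
    S = {p | ∃ y ∈ K.feasible, y i = p.1 ∧ y j = p.2}

/-- The Legendre polynomial of degree `N` (Rodrigues' formula). -/
def legendrePoly (N : ℕ) : Polynomial ℝ :=
  Polynomial.C (1 / (2 ^ N * (N.factorial : ℝ))) *
    Polynomial.derivative^[N] ((Polynomial.X ^ 2 - 1) ^ N)

/-- The nodes of the `N`-point Gauss(-Legendre) quadrature on `[-1, 1]`: the real roots of the
Legendre polynomial of degree `N`. -/
def gaussNodes (N : ℕ) : Finset ℝ :=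
  (legendrePoly N).roots.toFinset

/-- The weight of the node `k` in the `N`-point Gauss quadrature: the integral over `[-1, 1]` of the
Lagrange basis polynomial belonging to that node. -/
def gaussWeight (N : ℕ) (k : gaussNodes N) : ℝ :=
  ∫ s in (-1 : ℝ)..1, (Lagrange.basis (gaussNodes N) id (k : ℝ)).eval s

/-- The scaled generating function `φ₃(t, x) = (x/x̂ - 1) / (2 + (t + 1)(x/x̂ - 1))`, over `ℝ` or over
`ℂ`. -/
def phi3 {F : Type*} [Field F] (xhat t x : F) : F :=
  (x / xhat - 1) / (2 + (t + 1) * (x / xhat - 1))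

/-- The set of `x ∈ [1/M, M]` with `1 - δ ≤ x/x̂ ≤ 1 + δ`. -/
def scaledDomain (M δ xhat : ℝ) : Set ℝ :=
  {x | x ∈ Icc (1 / M) M ∧ 1 - δ ≤ x / xhat ∧ x / xhat ≤ 1 + δ}

/-- `hyp log(α) = {(x, ν) : log x ≥ ν - α}` over the domain `D`. -/
def hypLog (D : Set ℝ) (α : ℝ) : Set (ℝ × ℝ) :=
  {p | p.1 ∈ D ∧ p.2 - α ≤ Real.log p.1}

/-- The hypograph `{(x, v) : φ(t, x) ≥ v}` of `φ(t, ·)` over the domain `D`. -/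
def hypGen (D : Set ℝ) (φ : ℝ → ℝ → ℝ) (t : ℝ) : Set (ℝ × ℝ) :=
  {p | p.1 ∈ D ∧ p.2 ≤ φ t p.1}

/-- The `N`-point Gauss approximation of the hypograph of the logarithm over `D` obtained from a
function `φ` whose integral over `t ∈ [-1, 1]` is `log x + c`: the pairs `(x, ν)` with `x ∈ D` for which
there are `v_k` with `∑ w_k v_k ≥ ν + c` and `(x, v_k) ∈ hyp φ(t_k)` for all `k`. -/
def approxHyp (D : Set ℝ) (φ : ℝ → ℝ → ℝ) (c : ℝ) (N : ℕ) : Set (ℝ × ℝ) :=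
  {p | p.1 ∈ D ∧ ∃ v : gaussNodes N → ℝ,
    p.2 + c ≤ ∑ k, gaussWeight N k * v k ∧
    ∀ k : gaussNodes N, (p.1, v k) ∈ hypGen D φ (k : ℝ)}

/-- The approximation `Ĥ_{φ₃,N}` over `D`, for which the additive constant is `-log x̂`. -/
def approxHyp3 (D : Set ℝ) (xhat : ℝ) (N : ℕ) : Set (ℝ × ℝ) :=
  approxHyp D (phi3 xhat) (-Real.log xhat) N

/-- The explicit second-order cone form of `Ĥ_{φ₃,N}`. -/
def socForm3 (D : Set ℝ) (xhat : ℝ) (N : ℕ) : Set (ℝ × ℝ) :=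
  {p | p.1 ∈ D ∧ ∃ v r₁ r₂ : gaussNodes N → ℝ,
    p.2 - Real.log xhat ≤ ∑ k, gaussWeight N k * v k ∧
    (∀ k, r₁ k = 1 - ((k : ℝ) + 1) * v k ∧ 0 ≤ r₁ k) ∧
    (∀ k, r₂ k = (p.1 / xhat - 1) - 2 * v k ∧ 0 ≤ r₂ k) ∧
    ∀ k, ![v k * Real.sqrt (8 * ((k : ℝ) + 1)), r₁ k - r₂ k, r₁ k + r₂ k] ∈ lorentzCone 2}

/-- The point of the Bernstein ellipse with parameter `ρ` at angle `θ`: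
`(ρ/2) exp(iθ) + (ρ⁻¹/2) exp(-iθ)`. -/
def bernsteinPoint (ρ θ : ℝ) : ℂ :=
  (ρ : ℂ) / 2 * Complex.exp (Complex.I * θ) + (ρ : ℂ)⁻¹ / 2 * Complex.exp (-(Complex.I * θ))

/-- The rate `log(1-δ)/log δ + log ε/log δ`. -/
def pointRate (δ ε : ℝ) : ℝ :=
  Real.log (1 - δ) / Real.log δ + Real.log ε / Real.log δ

end LogSOC

end

namespace LogSOC

open Polynomial

/-! Write `u = x / xhat - 1`, so `|u| ≤ δ`. Accuracy: with `b = u / (2 + u)` the integrand becomes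
`b / (1 + t b)`, whose integral over `[-1, 1]` is `log (1 + u)`. Cut its geometric series after `2N`
terms: Gauss quadrature is exact on the polynomial part, and since its weights are positive with sum
2, quadrature and integral of the remainder lie in the same short interval (`abs_gauss_error_le`).
As `|b| ≤ δ / (2 - δ)`, the error is at most `δ ^ (2N) / (1 - δ)`, so half of `pointRate` many
points suffice. The Bernstein ellipse bound is a separate claim and plays no role in this estimate.
Conic form: clearing the positive denominator in `v ≤ u / (2 + τ u)` gives a rotated cone condition
(`le_div_iff_mem_lorentzCone`). The properties of Gauss quadrature are derived from Rodrigues'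
formula. -/

/-! ### Legendre polynomials and their roots -/

theorem natDegree_sq_sub_one_pow (N : ℕ) : ((X ^ 2 - 1 : ℝ[X]) ^ N).natDegree = 2 * N := by
  have h : (X ^ 2 - 1 : ℝ[X]).natDegree = 2 := by
    simpa using natDegree_X_pow_sub_C (R := ℝ) (n := 2) (r := 1)
  rw [natDegree_pow, h, mul_comm]

theorem coeff_sq_sub_one_pow (N : ℕ) : ((X ^ 2 - 1 : ℝ[X]) ^ N).coeff (2 * N) = 1 := by
  have h : (X ^ 2 - 1 : ℝ[X]).Monic := by
    simpa using monic_X_pow_sub_C (1 : ℝ) (two_ne_zero)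
  have := (h.pow N).coeff_natDegree
  rwa [natDegree_sq_sub_one_pow] at this

theorem iterate_derivative_sq_sub_one_pow_ne_zero {N k : ℕ} (hk : k ≤ 2 * N) :
    derivative^[k] ((X ^ 2 - 1 : ℝ[X]) ^ N) ≠ 0 := by
  intro h
  have h1 := coeff_iterate_derivative (p := (X ^ 2 - 1 : ℝ[X]) ^ N) (k := k) (2 * N - k)
  rw [h, Nat.sub_add_cancel hk, coeff_sq_sub_one_pow] at h1
  simp only [coeff_zero, nsmul_eq_mul, mul_one] at h1
  have h2 := Nat.descFactorial_eq_zero_iff_lt.1 (Nat.cast_eq_zero.1 h1.symm)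
  omega

/-- Each differentiation lowers the multiplicity of the roots `±1` by at most one. -/
theorem eval_iterate_derivative_sq_sub_one_pow {N k : ℕ} (hk : k < N) {a : ℝ} (ha : a ^ 2 = 1) :
    (derivative^[k] ((X ^ 2 - 1 : ℝ[X]) ^ N)).eval a = 0 := by
  obtain ⟨g, hg⟩ := pow_sub_dvd_iterate_derivative_pow (X ^ 2 - 1 : ℝ[X]) N k
  rw [hg, eval_mul, eval_pow]
  simp [ha, zero_pow (Nat.sub_ne_zero_of_lt hk)]

theorem natDegree_iterate_derivative_sq_sub_one_pow (N : ℕ) :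
    (derivative^[N] ((X ^ 2 - 1 : ℝ[X]) ^ N)).natDegree ≤ N := by
  have := natDegree_iterate_derivative ((X ^ 2 - 1 : ℝ[X]) ^ N) N
  rw [natDegree_sq_sub_one_pow] at this
  omega

/-- By Rolle's theorem, the `k`-th derivative of `(X² - 1) ^ N` has at least `k` roots other
than `±1`. -/
theorem le_card_roots_iterate_derivative (N : ℕ) : ∀ k ≤ N,
    k ≤ ((derivative^[k] ((X ^ 2 - 1 : ℝ[X]) ^ N)).roots.toFinset \ {1, -1}).card := by
  intro k
  induction k with
  | zero => simp
  | succ k ih =>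
    intro hk
    set p := derivative^[k] ((X ^ 2 - 1 : ℝ[X]) ^ N) with hp
    have hp0 : p ≠ 0 := iterate_derivative_sq_sub_one_pow_ne_zero (by omega)
    have hsub : ({1, -1} : Finset ℝ) ⊆ p.roots.toFinset := by
      intro a ha
      rw [Multiset.mem_toFinset, mem_roots hp0]
      refine eval_iterate_derivative_sq_sub_one_pow (by omega) ?_
      rcases Finset.mem_insert.1 ha with rfl | ha
      · norm_num
      · rw [Finset.mem_singleton.1 ha]; norm_num
    have h2 : ({1, -1} : Finset ℝ).card = 2 := Finset.card_pair (by norm_num)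
    have h3 := ih (by omega)
    rw [Finset.card_sdiff_of_subset hsub, h2] at h3
    have h4 : 2 ≤ p.roots.toFinset.card := h2 ▸ Finset.card_le_card hsub
    -- Together with `±1` there are at least `k + 2` roots, hence `k + 1` gaps, each holding a new
    -- root of the derivative.
    have h5 := card_roots_toFinset_le_card_roots_derivative_sdiff_roots_succ p
    have h6 : (p.derivative.roots.toFinset \ p.roots.toFinset).card ≤
        (p.derivative.roots.toFinset \ {1, -1}).card :=
      Finset.card_le_card (Finset.sdiff_subset_sdiff subset_rfl hsub)
    rw [Function.iterate_succ_apply', ← hp]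
    omega

theorem legendrePoly_scale_ne_zero (N : ℕ) : (1 / (2 ^ N * (N.factorial : ℝ))) ≠ 0 := by
  positivity

theorem legendrePoly_ne_zero (N : ℕ) : legendrePoly N ≠ 0 :=
  mul_ne_zero (C_ne_zero.2 (legendrePoly_scale_ne_zero N))
    (iterate_derivative_sq_sub_one_pow_ne_zero (by omega))

theorem card_gaussNodes (N : ℕ) : (gaussNodes N).card = N := by
  have h : gaussNodes N = (derivative^[N] ((X ^ 2 - 1 : ℝ[X]) ^ N)).roots.toFinset := by
    rw [gaussNodes, legendrePoly, roots_C_mul _ (legendrePoly_scale_ne_zero N)]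
  rw [h]
  refine le_antisymm ?_ ?_
  · exact (Multiset.toFinset_card_le _).trans
      ((card_roots' _).trans (natDegree_iterate_derivative_sq_sub_one_pow N))
  · exact (le_card_roots_iterate_derivative N N le_rfl).trans
      (Finset.card_le_card Finset.sdiff_subset)

theorem natDegree_legendrePoly (N : ℕ) : (legendrePoly N).natDegree = N := by
  refine le_antisymm ?_ ?_
  · exact (natDegree_C_mul_le _ _).trans (natDegree_iterate_derivative_sq_sub_one_pow N)
  · conv_lhs => rw [← card_gaussNodes N]
    exact (Multiset.toFinset_card_le _).trans (card_roots' _)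

/-! ### Orthogonality and exactness of Gauss quadrature -/

theorem intervalIntegrable_eval (p : ℝ[X]) (a b : ℝ) :
    IntervalIntegrable (fun s => p.eval s) MeasureTheory.volume a b :=
  p.continuous.intervalIntegrable a b

/-- Repeated integration by parts: the boundary terms vanish at `±1`, and each step lowers the
degree of `q` until it is zero. -/
theorem integral_iterate_derivative_mul_eq_zero (N : ℕ) : ∀ k ≤ N, ∀ q : ℝ[X], q.degree < k →
    ∫ s in (-1 : ℝ)..1, (derivative^[k] ((X ^ 2 - 1 : ℝ[X]) ^ N)).eval s * q.eval s = 0 := by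
  intro k
  induction k with
  | zero =>
    intro _ q hq
    have : q = 0 := by
      rw [← degree_eq_bot]
      exact Nat.WithBot.lt_zero_iff.1 hq
    simp [this]
  | succ k ih =>
    intro hk q hq
    have hd : q.derivative.degree < k := by
      rcases eq_or_ne q 0 with rfl | h0
      · simp
      · have := degree_derivative_lt h0
        exact this.trans_le (Order.le_of_lt_succ (by exact_mod_cast hq))
    have h := intervalIntegral.integral_mul_deriv_eq_deriv_mul (a := -1) (b := 1)
      (u := fun s => q.eval s) (u' := fun s => q.derivative.eval s)
      (v := fun s => (derivative^[k] ((X ^ 2 - 1 : ℝ[X]) ^ N)).eval s)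
      (v' := fun s => (derivative (derivative^[k] ((X ^ 2 - 1 : ℝ[X]) ^ N))).eval s)
      (fun x _ => q.hasDerivAt x) (fun x _ => Polynomial.hasDerivAt _ x)
      (intervalIntegrable_eval _ _ _) (intervalIntegrable_eval _ _ _)
    rw [eval_iterate_derivative_sq_sub_one_pow (by omega) (by norm_num),
      eval_iterate_derivative_sq_sub_one_pow (by omega) (by norm_num)] at h
    rw [Function.iterate_succ_apply']
    simp_rw [mul_comm _ (q.eval _)]
    rw [h]
    simp_rw [mul_comm (q.derivative.eval _)]
    rw [ih (by omega) _ hd]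
    simp

/-- The Legendre polynomial of degree `N` is orthogonal to all polynomials of lower degree. -/
theorem integral_legendrePoly_mul_eq_zero {N : ℕ} {q : ℝ[X]} (hq : q.degree < N) :
    ∫ s in (-1 : ℝ)..1, (legendrePoly N * q).eval s = 0 := by
  simp_rw [legendrePoly, eval_mul, eval_C, mul_assoc]
  rw [intervalIntegral.integral_const_mul,
    integral_iterate_derivative_mul_eq_zero N N le_rfl q hq, mul_zero]

theorem eval_legendrePoly_of_mem {N : ℕ} {t : ℝ} (ht : t ∈ gaussNodes N) :
    (legendrePoly N).eval t = 0 :=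
  (mem_roots (legendrePoly_ne_zero N)).1 (Multiset.mem_toFinset.1 ht)

theorem gauss_exact_of_degree_lt_card {N : ℕ} {p : ℝ[X]} (hp : p.degree < N) :
    ∫ s in (-1 : ℝ)..1, p.eval s = ∑ k : gaussNodes N, gaussWeight N k * p.eval (k : ℝ) := by
  have h := Lagrange.eq_interpolate (s := gaussNodes N) (v := id) (f := p)
    Function.injective_id.injOn (by rwa [card_gaussNodes])
  conv_lhs => rw [h]
  simp_rw [Lagrange.interpolate_apply, eval_finsetSum, eval_mul, eval_C]
  rw [intervalIntegral.integral_finsetSum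
    (fun i _ => ((intervalIntegrable_eval _ _ _).const_mul _)), ← Finset.sum_coe_sort]
  refine Finset.sum_congr rfl fun k _ => ?_
  rw [intervalIntegral.integral_const_mul, gaussWeight, mul_comm]
  rfl

/-- The `N`-point Gauss quadrature is exact on polynomials of degree less than `2 * N`. -/
theorem gauss_exact {N : ℕ} {p : ℝ[X]} (hp : p.degree < ((2 * N : ℕ) : WithBot ℕ)) :
    ∫ s in (-1 : ℝ)..1, p.eval s = ∑ k : gaussNodes N, gaussWeight N k * p.eval (k : ℝ) := by
  have hL := legendrePoly_ne_zero N
  have hdeg : (legendrePoly N).degree = N := by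
    rw [degree_eq_natDegree hL, natDegree_legendrePoly]
  have hr : (p % legendrePoly N).degree < N := hdeg ▸ degree_mod_lt p hL
  have hpq : legendrePoly N * (p / legendrePoly N) + p % legendrePoly N = p :=
    EuclideanDomain.div_add_mod p _
  -- The quotient has degree below `N`, so its product with the Legendre polynomial integrates to
  -- zero; that product also vanishes at the nodes.
  have hq : (p / legendrePoly N).degree < N := by
    by_cases hle : (legendrePoly N).degree ≤ p.degree
    · have h := degree_add_div hL hle
      rw [hdeg] at h
      rw [← h] at hp
      by_contra hcon
      push Not at hcon
      have : ((2 * N : ℕ) : WithBot ℕ) ≤ N + (p / legendrePoly N).degree := by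
        rw [two_mul, Nat.cast_add]
        gcongr
      exact absurd hp this.not_gt
    · rw [(Polynomial.div_eq_zero_iff hL).2 (not_le.1 hle)]
      simp
  have hint : ∫ s in (-1 : ℝ)..1, p.eval s = ∫ s in (-1 : ℝ)..1, (p % legendrePoly N).eval s := by
    conv_lhs => rw [← hpq]
    simp_rw [eval_add]
    rw [intervalIntegral.integral_add (intervalIntegrable_eval _ _ _)
      (intervalIntegrable_eval _ _ _), integral_legendrePoly_mul_eq_zero hq, zero_add]
  rw [hint, gauss_exact_of_degree_lt_card hr]
  refine Finset.sum_congr rfl fun k _ => ?_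
  conv_rhs => rw [← hpq]
  rw [eval_add, eval_mul, eval_legendrePoly_of_mem k.2, zero_mul, zero_add]

/-! ### Positivity of the weights and location of the nodes -/

/-- The integrand has degree at most `2N - 1`, so quadrature is exact, and the squared Lagrange
basis polynomial kills every node but `k`. Taking `g = 1` gives positive weights; `g = X + 1` and `g
= 1 - X` locate the nodes. -/
theorem gaussWeight_mul_eq_integral {N : ℕ} (k : gaussNodes N) {g : ℝ[X]} (hg : g.natDegree ≤ 1) :
    gaussWeight N k * g.eval (k : ℝ) =
      ∫ s in (-1 : ℝ)..1, g.eval s * (Lagrange.basis (gaussNodes N) id (k : ℝ)).eval s ^ 2 := by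
  set l := Lagrange.basis (gaussNodes N) id (k : ℝ) with hl
  have hN : 0 < N := by
    rw [← card_gaussNodes N]
    exact Finset.card_pos.2 ⟨k, k.2⟩
  have hld : l.natDegree = N - 1 := by
    rw [hl, Lagrange.natDegree_basis Function.injective_id.injOn k.2, card_gaussNodes]
  have hdeg : (g * l ^ 2).degree < ((2 * N : ℕ) : WithBot ℕ) := by
    refine degree_le_natDegree.trans_lt (Nat.cast_lt.2 ?_)
    have h1 : (g * l ^ 2).natDegree ≤ g.natDegree + (l ^ 2).natDegree := natDegree_mul_le
    have h2 : (l ^ 2).natDegree ≤ 2 * l.natDegree := natDegree_pow_le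
    omega
  have h := gauss_exact hdeg
  simp_rw [eval_mul, eval_pow] at h
  rw [h, Finset.sum_eq_single k]
  · have : l.eval (k : ℝ) = 1 := Lagrange.eval_basis_self (v := id) Function.injective_id.injOn k.2
    rw [this]; ring
  · intro j _ hjk
    have : l.eval (j : ℝ) = 0 :=
      Lagrange.eval_basis_of_ne (v := id) (fun h => hjk (Subtype.ext h.symm)) j.2
    rw [this]; ring
  · simp

theorem integral_mul_sq_pos {g l : ℝ[X]} (hg : ∀ s ∈ Ioo (-1 : ℝ) 1, 0 < g.eval s) (hl : l ≠ 0) :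
    0 < ∫ s in (-1 : ℝ)..1, g.eval s * l.eval s ^ 2 := by
  have hcont : Continuous fun s => g.eval s * l.eval s ^ 2 :=
    g.continuous.mul (l.continuous.pow 2)
  have hinf : (Ioo (-1 : ℝ) 1 \ l.roots.toFinset).Nonempty :=
    ((Ioo_infinite (by norm_num)).sdiff (Finset.finite_toSet _)).nonempty
  obtain ⟨c, hc, hcl⟩ := hinf
  have hlc : l.eval c ≠ 0 := fun h => hcl (by simpa [hl] using h)
  have hnn : ∀ s ∈ Icc (-1 : ℝ) 1, 0 ≤ g.eval s * l.eval s ^ 2 := by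
    intro s hs
    have h1 : Icc (-1 : ℝ) 1 ⊆ {s | 0 ≤ g.eval s} := by
      rw [← closure_Ioo (by norm_num)]
      exact closure_minimal (fun s hs => (hg s hs).le) (isClosed_le continuous_const g.continuous)
    exact mul_nonneg (h1 hs) (sq_nonneg _)
  exact intervalIntegral.integral_pos (by norm_num) hcont.continuousOn
    (fun s hs => hnn s (Ioc_subset_Icc_self hs))
    ⟨c, Ioo_subset_Icc_self hc, mul_pos (hg c hc) (by positivity)⟩

theorem gaussWeight_pos {N : ℕ} (k : gaussNodes N) : 0 < gaussWeight N k := by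
  have h := gaussWeight_mul_eq_integral k (g := 1) (by simp)
  have := integral_mul_sq_pos (g := 1) (fun s _ => by simp)
    (Lagrange.basis_ne_zero (v := id) Function.injective_id.injOn k.2)
  rw [← h] at this
  simpa using this

theorem gaussNode_mem_Ioo {N : ℕ} (k : gaussNodes N) : (k : ℝ) ∈ Ioo (-1 : ℝ) 1 := by
  have hl := Lagrange.basis_ne_zero (v := id) Function.injective_id.injOn k.2
  have key : ∀ g : ℝ[X], g.natDegree ≤ 1 → (∀ s ∈ Ioo (-1 : ℝ) 1, 0 < g.eval s) →
      0 < g.eval (k : ℝ) := by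
    intro g hg hpos
    have h := integral_mul_sq_pos hpos hl
    rw [← gaussWeight_mul_eq_integral k hg] at h
    exact (pos_iff_pos_of_mul_pos h).1 (gaussWeight_pos k)
  constructor
  · have := key (X + C 1) (natDegree_X_add_C 1).le (fun s hs => by simpa using by linarith [hs.1])
    simp at this; linarith
  · have := key (C 1 - X) ((natDegree_sub_le _ _).trans (by simp))
      (fun s hs => by simpa using hs.2)
    simpa using this

theorem sum_gaussWeight {N : ℕ} (hN : 1 ≤ N) : ∑ k, gaussWeight N k = 2 := by
  have h := gauss_exact (N := N) (p := 1) (by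
    rw [degree_one]
    exact_mod_cast (by omega : 0 < 2 * N))
  simp only [eval_one, mul_one, intervalIntegral.integral_const, smul_eq_mul] at h
  rw [← h]; norm_num

/-! ### Second-order cone systems and the scalar conic form -/

/-- The affine functionals on `ι → ℝ`. -/
def affineFunctionals (ι : Type*) [Fintype ι] : Submodule ℝ ((ι → ℝ) → ℝ) where
  carrier := {f | ∃ (a : ι → ℝ) (b : ℝ), ∀ y, f y = a ⬝ᵥ y + b}
  add_mem' := by
    rintro f g ⟨a, b, hf⟩ ⟨a', b', hg⟩
    refine ⟨a + a', b + b', fun y => ?_⟩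
    rw [Pi.add_apply, hf, hg, add_dotProduct]
    ring
  zero_mem' := ⟨0, 0, by simp⟩
  smul_mem' := by
    rintro c f ⟨a, b, hf⟩
    refine ⟨c • a, c * b, fun y => ?_⟩
    rw [Pi.smul_apply, hf, smul_dotProduct, smul_eq_mul, smul_eq_mul]
    ring

theorem const_mem_affineFunctionals {ι : Type*} [Fintype ι] (b : ℝ) :
    (fun _ => b) ∈ affineFunctionals ι :=
  ⟨0, b, by simp⟩

theorem eval_mem_affineFunctionals {ι : Type*} [Fintype ι] (i : ι) :
    (fun y => y i) ∈ affineFunctionals ι := by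
  classical
  exact ⟨Pi.single i 1, 0, by simp⟩

/-- Lets variables and constraints be indexed by arbitrary finite types, with matrices replaced by
affine functionals. -/
theorem hasSOCRepresentation_of_affine {ι κ : Type*} [Fintype ι] [Fintype κ] {n m : ℕ}
    (hn : Fintype.card ι = n) (hm : Fintype.card κ = m) {S : Set (ℝ × ℝ)}
    (F : κ → Fin 3 → (ι → ℝ) → ℝ) (hF : ∀ k c, F k c ∈ affineFunctionals ι)
    {i j : ι} (hij : i ≠ j)
    (hS : ∀ p, p ∈ S ↔
      ∃ y : ι → ℝ, (∀ k, (fun c => F k c y) ∈ lorentzCone 2) ∧ y i = p.1 ∧ y j = p.2) :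
    HasSOCRepresentation S n m := by
  choose a b hab using hF
  let e : ι ≃ Fin n := Fintype.equivFinOfCardEq hn
  let f : κ ≃ Fin m := Fintype.equivFinOfCardEq hm
  refine ⟨⟨fun r s => a (f.symm r) 0 (e.symm s), fun r s => a (f.symm r) 1 (e.symm s),
    fun r s => a (f.symm r) 2 (e.symm s), fun r => b (f.symm r) 0, fun r => b (f.symm r) 1,
    fun r => b (f.symm r) 2⟩, e i, e j, e.injective.ne hij, ?_⟩
  have hdot : ∀ (y : ι → ℝ) (k : κ) (c : Fin 3),
      (fun s => a k c (e.symm s)) ⬝ᵥ (fun s => y (e.symm s)) + b k c = F k c y := by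
    intro y k c
    rw [hab, dotProduct, dotProduct]
    congr 1
    exact e.symm.sum_comp fun s => a k c s * y s
  have hvec : ∀ (y : ι → ℝ) (k : κ), (fun c => F k c y) = ![F k 0 y, F k 1 y, F k 2 y] := by
    intro y k
    ext c
    fin_cases c <;> rfl
  ext p
  rw [hS]
  constructor
  · rintro ⟨y, hy, h1, h2⟩
    refine ⟨fun s => y (e.symm s), fun r => ?_, by simpa using h1, by simpa using h2⟩
    have h := hy (f.symm r)
    rw [hvec, ← hdot, ← hdot, ← hdot] at h
    exact h
  · rintro ⟨y, hy, h1, h2⟩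
    refine ⟨fun s => y (e s), fun k => ?_, h1, h2⟩
    have h := hy (f k)
    rw [hvec, ← hdot, ← hdot, ← hdot]
    simpa [Matrix.mulVec, Pi.add_apply] using h

theorem mem_lorentzCone_two {a b c : ℝ} :
    ![a, b, c] ∈ lorentzCone 2 ↔ Real.sqrt (a ^ 2 + b ^ 2) ≤ c := by
  simp [lorentzCone, Fin.sum_univ_two, Fin.last]

theorem zero_zero_mem_lorentzCone {c : ℝ} : ![0, 0, c] ∈ lorentzCone 2 ↔ 0 ≤ c := by
  simp [mem_lorentzCone_two]

/-- The scalar hypograph condition `v ≤ u / (2 + τ u)` in conic form. -/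
theorem le_div_iff_mem_lorentzCone {u v τ : ℝ} (hu : -1 < u) (hτ : 0 < τ) (hτ2 : τ < 2) :
    v ≤ u / (2 + τ * u) ↔ 0 ≤ 1 - τ * v ∧ 0 ≤ u - 2 * v ∧
      ![v * Real.sqrt (8 * τ), (1 - τ * v) - (u - 2 * v), (1 - τ * v) + (u - 2 * v)]
        ∈ lorentzCone 2 := by
  have hden : 0 < 2 + τ * u := by nlinarith
  have hs : Real.sqrt (8 * τ) ^ 2 = 8 * τ := Real.sq_sqrt (by positivity)
  -- With `r₁ = 1 - τ v` and `r₂ = u - 2 v`, the cone says `2 τ v² ≤ r₁ r₂`, because `(r₁ + r₂)² -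
  -- (r₁ - r₂)² = 4 r₁ r₂`. Expanding `r₁ r₂` cancels `2 τ v²` and leaves `v (2 + τ u) ≤ u`.
  rw [mem_lorentzCone_two, le_div_iff₀ hden, mul_pow, hs]
  constructor
  · intro h
    have h1 : 0 ≤ 1 - τ * v := by
      by_contra hc
      push Not at hc
      nlinarith
    have h2 : 0 ≤ u - 2 * v := by
      by_contra hc
      push Not at hc
      nlinarith [mul_pos (sub_pos.2 (sub_neg.1 hc)) hden, mul_nonneg hτ.le (sq_nonneg u)]
    refine ⟨h1, h2, Real.sqrt_le_iff.2 ⟨by linarith, ?_⟩⟩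
    nlinarith
  · rintro ⟨h1, h2, h3⟩
    have := (Real.sqrt_le_iff.1 h3).2
    nlinarith

/-! ### The bound on the Bernstein ellipse -/

theorem norm_bernsteinPoint_le {ρ : ℝ} (hρ : 0 < ρ) (θ : ℝ) :
    ‖bernsteinPoint ρ θ‖ ≤ ρ / 2 + ρ⁻¹ / 2 := by
  refine (norm_add_le _ _).trans ?_
  have h1 : ‖Complex.exp (Complex.I * θ)‖ = 1 := by
    rw [mul_comm]; exact Complex.norm_exp_ofReal_mul_I θ
  have h2 : ‖Complex.exp (-(Complex.I * θ))‖ = 1 := by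
    rw [Complex.exp_neg, norm_inv, h1, inv_one]
  rw [norm_mul, norm_mul, h1, h2]
  simp [abs_of_pos hρ]

theorem abs_div_sub_one_le {M δ xhat x : ℝ} (hx : x ∈ scaledDomain M δ xhat) :
    |x / xhat - 1| ≤ δ :=
  abs_le.2 ⟨by linarith [hx.2.1], by linarith [hx.2.2]⟩

/-- Reverse triangle inequality on `(2 + u) + z u`, with `|2 + u| ≥ 2 - |u| ≥ |u| (2 - δ) / δ`. The
factor `|u|` later cancels the numerator of `phi3`. -/
theorem abs_div_le_norm_den {δ u : ℝ} (hδ : 0 < δ) (hu : |u| ≤ δ) (z : ℂ) :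
    |u| * ((2 - δ) / δ - ‖z‖) ≤ ‖2 + (z + 1) * (u : ℂ)‖ := by
  have h1 : ‖((2 + u : ℝ) : ℂ)‖ - ‖-(z * (u : ℂ))‖ ≤ ‖2 + (z + 1) * (u : ℂ)‖ := by
    refine (norm_sub_norm_le _ _).trans_eq ?_
    congr 1
    push_cast
    ring
  rw [norm_neg, norm_mul, Complex.norm_real, Complex.norm_real, Real.norm_eq_abs,
    Real.norm_eq_abs] at h1
  have h2 : |u| * ((2 - δ) / δ) ≤ |2 + u| := by
    rw [mul_div_assoc', div_le_iff₀ hδ]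
    have h3 : 2 - |u| ≤ |2 + u| := by
      have := neg_abs_le u
      exact (by linarith : 2 - |u| ≤ 2 + u).trans (le_abs_self _)
    nlinarith [abs_nonneg u]
  nlinarith

theorem phi3_bernstein_bound {δ ρ L : ℝ} (hδ : 0 < δ) (hδ1 : δ < 1) (hρ : ρ = (2 - δ) / δ)
    (hL : L = ((2 - δ) / δ - ρ / 2 - ρ⁻¹ / 2)⁻¹) :
    1 < ρ ∧ 0 < L ∧ ∀ M xhat : ℝ, ∀ x ∈ scaledDomain M δ xhat, ∀ θ : ℝ,
      (2 + (bernsteinPoint ρ θ + 1) * ((x : ℂ) / (xhat : ℂ) - 1) ≠ 0) ∧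
      ‖phi3 (xhat : ℂ) (bernsteinPoint ρ θ) (x : ℂ)‖ ≤ L := by
  have hρ1 : 1 < ρ := by
    rw [hρ, lt_div_iff₀ hδ]; linarith
  have hinv : ρ⁻¹ < 1 := inv_lt_one_of_one_lt₀ hρ1
  have hgap : 0 < (2 - δ) / δ - ρ / 2 - ρ⁻¹ / 2 := by
    rw [← hρ]; linarith
  have hLpos : 0 < L := hL ▸ inv_pos.2 hgap
  refine ⟨hρ1, hLpos, fun M xhat x hx θ => ?_⟩
  have hu := abs_div_sub_one_le hx
  have hcast : (x : ℂ) / (xhat : ℂ) - 1 = ((x / xhat - 1 : ℝ) : ℂ) := by push_cast; ring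
  rw [phi3, hcast]
  set u := x / xhat - 1
  set z := bernsteinPoint ρ θ
  have hz : ‖z‖ ≤ ρ / 2 + ρ⁻¹ / 2 := norm_bernsteinPoint_le (by linarith) θ
  have hden : |u| * L⁻¹ ≤ ‖2 + (z + 1) * (u : ℂ)‖ := by
    refine le_trans ?_ (abs_div_le_norm_den hδ hu z)
    rw [hL, inv_inv]
    exact mul_le_mul_of_nonneg_left (by linarith) (abs_nonneg u)
  -- At `u = 0` the lower bound is trivial, but the denominator is 2 and the numerator 0.
  rcases eq_or_ne u 0 with h0 | h0
  · rw [h0]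
    simp [hLpos.le]
  · have hpos : 0 < |u| * L⁻¹ := mul_pos (abs_pos.2 h0) (inv_pos.2 hLpos)
    refine ⟨norm_pos_iff.1 (hpos.trans_le hden), ?_⟩
    rw [norm_div, Complex.norm_real, Real.norm_eq_abs, div_le_iff₀ (hpos.trans_le hden)]
    have := mul_le_mul_of_nonneg_left hden hLpos.le
    rwa [mul_comm |u|, ← mul_assoc, mul_inv_cancel₀ hLpos.ne', one_mul] at this

/-! ### The conic representation of the approximation -/

theorem xhat_pos {M xhat : ℝ} (hM : 1 < M) (hx : xhat ∈ Icc (1 / M) M) : 0 < xhat :=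
  (by positivity : 0 < 1 / M).trans_le hx.1

theorem approxHyp3_eq_socForm3 {M δ xhat : ℝ} (hδ1 : δ < 1) (N : ℕ) :
    approxHyp3 (scaledDomain M δ xhat) xhat N = socForm3 (scaledDomain M δ xhat) xhat N := by
  ext ⟨x, ν⟩
  have key : x ∈ scaledDomain M δ xhat → ∀ (k : gaussNodes N) (v : ℝ), v ≤ phi3 xhat (k : ℝ) x ↔ _ :=
    fun hx k v => le_div_iff_mem_lorentzCone (τ := (k : ℝ) + 1)
      (by linarith [hx.2.1] : -1 < x / xhat - 1)
      (by linarith [(gaussNode_mem_Ioo k).1]) (by linarith [(gaussNode_mem_Ioo k).2])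
  constructor
  · rintro ⟨hx, v, hv, h⟩
    have h' := fun k => (key hx k _).1 (h k).2
    exact ⟨hx, v, _, _, hv, fun k => ⟨rfl, (h' k).1⟩, fun k => ⟨rfl, (h' k).2.1⟩,
      fun k => (h' k).2.2⟩
  · rintro ⟨hx, v, r₁, r₂, hv, h1, h2, h3⟩
    refine ⟨hx, v, hv, fun k => ⟨hx, (key hx k _).2 ⟨?_, ?_, ?_⟩⟩⟩
    · rw [← (h1 k).1]; exact (h1 k).2
    · rw [← (h2 k).1]; exact (h2 k).2
    · rw [← (h1 k).1, ← (h2 k).1]; exact h3 k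

theorem hasSOCRepresentation_socForm3 (M δ xhat : ℝ) (N : ℕ) :
    HasSOCRepresentation (socForm3 (scaledDomain M δ xhat) xhat N) (N + 2) (3 * N + 5) := by
  let ι := gaussNodes N ⊕ Fin 2
  let r₁ : gaussNodes N → (ι → ℝ) → ℝ := fun k => (fun _ => 1) - ((k : ℝ) + 1) • fun y => y (.inl k)
  let r₂ : gaussNodes N → (ι → ℝ) → ℝ := fun k =>
    (xhat⁻¹ • (fun y => y (.inr 0)) - fun _ => 1) - (2 : ℝ) • fun y => y (.inl k)
  have hv : ∀ k, (fun y : ι → ℝ => y k) ∈ affineFunctionals ι := eval_mem_affineFunctionals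
  have hc : ∀ c : ℝ, (fun _ => c) ∈ affineFunctionals ι := const_mem_affineFunctionals
  have h0 : (0 : (ι → ℝ) → ℝ) ∈ affineFunctionals ι := zero_mem _
  have hr₁ : ∀ k, r₁ k ∈ affineFunctionals ι := fun k =>
    sub_mem (hc _) (Submodule.smul_mem _ _ (hv _))
  have hr₂ : ∀ k, r₂ k ∈ affineFunctionals ι := fun k =>
    sub_mem (sub_mem (Submodule.smul_mem _ _ (hv _)) (hc _)) (Submodule.smul_mem _ _ (hv _))
  let A : Fin 5 → (ι → ℝ) → ℝ :=
    ![(fun y => y (.inr 0)) - fun _ => 1 / M,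
      (fun _ => M) - fun y => y (.inr 0),
      xhat⁻¹ • (fun y => y (.inr 0)) - fun _ => 1 - δ,
      (fun _ => 1 + δ) - xhat⁻¹ • fun y => y (.inr 0),
      (∑ k, gaussWeight N k • fun y => y (.inl k)) -
        ((fun y => y (.inr 1)) - fun _ => Real.log xhat)]
  have hA : ∀ i, A i ∈ affineFunctionals ι := by
    intro i
    fin_cases i
    · exact sub_mem (hv _) (hc _)
    · exact sub_mem (hc _) (hv _)
    · exact sub_mem (Submodule.smul_mem _ _ (hv _)) (hc _)
    · exact sub_mem (hc _) (Submodule.smul_mem _ _ (hv _))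
    · exact sub_mem (sum_mem fun k _ => Submodule.smul_mem _ _ (hv _)) (sub_mem (hv _) (hc _))
  -- Three constraints per node (the cone and two signs), plus four bounds on `x` and the quadrature
  -- inequality. An affine inequality `0 ≤ c` is encoded as `(0, 0, c)`.
  let F : (gaussNodes N × Fin 3) ⊕ Fin 5 → Fin 3 → (ι → ℝ) → ℝ :=
    Sum.elim
      (fun q => ![![Real.sqrt (8 * ((q.1 : ℝ) + 1)) • fun y => y (.inl q.1),
          r₁ q.1 - r₂ q.1, r₁ q.1 + r₂ q.1],
        ![0, 0, r₁ q.1], ![0, 0, r₂ q.1]] q.2)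
      (fun i => ![0, 0, A i])
  refine hasSOCRepresentation_of_affine (ι := ι) (κ := (gaussNodes N × Fin 3) ⊕ Fin 5)
    (by simp [ι, card_gaussNodes]) (by simp [card_gaussNodes, mul_comm]) F ?_
    (i := .inr 0) (j := .inr 1) (Sum.inr_injective.ne (by decide)) ?_
  · rintro (⟨k, c⟩ | i) d
    · fin_cases c <;> fin_cases d
      · exact Submodule.smul_mem _ _ (hv _)
      · exact sub_mem (hr₁ k) (hr₂ k)
      · exact add_mem (hr₁ k) (hr₂ k)
      · exact h0
      · exact h0
      · exact hr₁ k
      · exact h0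
      · exact h0
      · exact hr₂ k
    · fin_cases d
      · exact h0
      · exact h0
      · exact hA i
  · have hvec : ∀ (f : Fin 3 → (ι → ℝ) → ℝ) (y : ι → ℝ),
        (fun c => f c y) = ![f 0 y, f 1 y, f 2 y] := by
      intro f y
      ext c
      fin_cases c <;> rfl
    have hF : ∀ y : ι → ℝ, (∀ q, (fun c => F q c y) ∈ lorentzCone 2) ↔
        (∀ k, ![y (.inl k) * Real.sqrt (8 * ((k : ℝ) + 1)), r₁ k y - r₂ k y, r₁ k y + r₂ k y]
          ∈ lorentzCone 2) ∧ (∀ k, 0 ≤ r₁ k y) ∧ (∀ k, 0 ≤ r₂ k y) ∧ ∀ i, 0 ≤ A i y := by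
      intro y
      simp only [Sum.forall, Prod.forall, Fin.forall_fin_succ (n := 2),
        Fin.forall_fin_two, hvec, forall_and, F]
      simp [zero_zero_mem_lorentzCone, mul_comm, and_assoc, Fin.forall_fin_succ]
    have hAy : ∀ y : ι → ℝ, (∀ i, 0 ≤ A i y) ↔
        y (.inr 0) ∈ scaledDomain M δ xhat ∧
          y (.inr 1) - Real.log xhat ≤ ∑ k, gaussWeight N k * y (.inl k) := by
      intro y
      simp [Fin.forall_fin_succ, A, scaledDomain, div_eq_inv_mul, and_assoc, Finset.sum_apply]
    rintro ⟨x, ν⟩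
    simp only [hF, hAy]
    constructor
    · rintro ⟨hx, v, s₁, s₂, hs, h1, h2, h3⟩
      have e1 : ∀ k, r₁ k (Sum.elim v ![x, ν]) = s₁ k := fun k => by
        rw [(h1 k).1]; simp [r₁]
      have e2 : ∀ k, r₂ k (Sum.elim v ![x, ν]) = s₂ k := fun k => by
        rw [(h2 k).1]; simp [r₂, div_eq_inv_mul]
      refine ⟨Sum.elim v ![x, ν], ⟨fun k => ?_, fun k => ?_, fun k => ?_, ?_, ?_⟩, rfl, rfl⟩
      · rw [e1, e2]; exact h3 k
      · rw [e1]; exact (h1 k).2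
      · rw [e2]; exact (h2 k).2
      · exact hx
      · exact hs
    · rintro ⟨y, ⟨h3, h1, h2, hx, hs⟩, rfl, rfl⟩
      exact ⟨hx, fun k => y (.inl k), fun k => r₁ k y, fun k => r₂ k y, hs,
        fun k => ⟨by simp [r₁], h1 k⟩, fun k => ⟨by simp [r₂, div_eq_inv_mul], h2 k⟩, h3⟩

/-! ### Quadrature error for the logarithm -/

theorem one_add_mul_pos {b t : ℝ} (hb : |b| < 1) (ht : t ∈ Icc (-1 : ℝ) 1) :
    1 - |b| ≤ 1 + t * b ∧ 0 < 1 + t * b := by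
  have h : |t * b| ≤ |b| := by
    rw [abs_mul]
    exact mul_le_of_le_one_left (abs_nonneg b) (abs_le.2 ht)
  have := neg_abs_le (t * b)
  constructor <;> linarith

theorem integral_inv_one_add_mul {b : ℝ} (hb : |b| < 1) :
    ∫ t in (-1 : ℝ)..1, b / (1 + t * b) = Real.log (1 + b) - Real.log (1 - b) := by
  have h := intervalIntegral.integral_eq_sub_of_hasDerivAt (a := -1) (b := 1)
    (f := fun t : ℝ => Real.log (1 + t * b)) (f' := fun t => b / (1 + t * b))
    (fun t ht => by
      rw [uIcc_of_le (by norm_num)] at ht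
      have h1 : HasDerivAt (fun t : ℝ => 1 + t * b) b t := by
        simpa using ((hasDerivAt_id t).mul_const b).const_add 1
      exact h1.log (one_add_mul_pos hb ht).2.ne')
    (ContinuousOn.intervalIntegrable fun t ht => by
      rw [uIcc_of_le (by norm_num)] at ht
      exact ContinuousAt.continuousWithinAt
        (by have := (one_add_mul_pos hb ht).2.ne'; fun_prop (disch := assumption)))
  rw [h]
  ring_nf

/-- The error of the `N`-point Gauss quadrature for `t ↦ b / (1 + t b)`. -/
theorem abs_gauss_error_le {b : ℝ} (hb : |b| < 1) {N : ℕ} (hN : 1 ≤ N) :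
    |∑ k : gaussNodes N, gaussWeight N k * (b / (1 + (k : ℝ) * b)) -
        (Real.log (1 + b) - Real.log (1 - b))| ≤ 2 * |b| * |b| ^ (2 * N) / (1 - |b|) := by
  -- The truncated geometric series of `b / (1 + t b)`; the remainder is `b * g t`, where `g` is
  -- nonnegative because `2N` is even.
  let p : ℝ[X] := ∑ i ∈ Finset.range (2 * N), C (b * (-b) ^ i) * X ^ i
  let g : ℝ → ℝ := fun t => (t * b) ^ (2 * N) / (1 + t * b)
  have hp : p.degree < ((2 * N : ℕ) : WithBot ℕ) := by
    refine (degree_sum_le _ _).trans_lt ((Finset.sup_lt_iff (WithBot.bot_lt_coe _)).2 ?_)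
    intro i hi
    exact (degree_C_mul_X_pow_le _ _).trans_lt (Nat.cast_lt.2 (Finset.mem_range.1 hi))
  have hsplit : ∀ t ∈ Icc (-1 : ℝ) 1, b / (1 + t * b) = p.eval t + b * g t := by
    intro t ht
    have hpos := (one_add_mul_pos hb ht).2
    have hgeom := mul_neg_geom_sum (-(t * b)) (2 * N)
    have hev : p.eval t = b * ∑ i ∈ Finset.range (2 * N), (-(t * b)) ^ i := by
      simp only [p, eval_finsetSum, eval_mul, eval_C, eval_pow, eval_X, Finset.mul_sum]
      refine Finset.sum_congr rfl fun i _ => ?_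
      rw [mul_assoc, ← mul_pow]
      ring
    rw [Even.neg_pow (even_two_mul N)] at hgeom
    rw [hev]
    simp only [g]
    rw [div_eq_iff hpos.ne', add_mul, mul_assoc b (_ / _), div_mul_cancel₀ _ hpos.ne']
    linear_combination (-b) * hgeom
  have hg0 : ∀ t ∈ Icc (-1 : ℝ) 1, 0 ≤ g t := fun t ht =>
    div_nonneg ((even_two_mul N).pow_nonneg _) (one_add_mul_pos hb ht).2.le
  have hg1 : ∀ t ∈ Icc (-1 : ℝ) 1, g t ≤ |b| ^ (2 * N) / (1 - |b|) := by
    intro t ht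
    have h1 : (t * b) ^ (2 * N) ≤ |b| ^ (2 * N) := by
      rw [← Even.pow_abs (even_two_mul N) (t * b), abs_mul]
      gcongr
      exact mul_le_of_le_one_left (abs_nonneg b) (abs_le.2 ht)
    exact div_le_div₀ (by positivity) h1 (by linarith) (one_add_mul_pos hb ht).1
  have hgint : IntervalIntegrable g MeasureTheory.volume (-1) 1 :=
    ContinuousOn.intervalIntegrable fun t ht => by
      rw [uIcc_of_le (by norm_num)] at ht
      have := (one_add_mul_pos hb ht).2.ne'
      exact ContinuousAt.continuousWithinAt (by fun_prop (disch := assumption))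
  set K := |b| ^ (2 * N) / (1 - |b|) with hK
  have hI : Real.log (1 + b) - Real.log (1 - b) =
      (∫ t in (-1 : ℝ)..1, p.eval t) + b * ∫ t in (-1 : ℝ)..1, g t := by
    rw [← integral_inv_one_add_mul hb, ← intervalIntegral.integral_const_mul,
      ← intervalIntegral.integral_add (intervalIntegrable_eval _ _ _) (hgint.const_mul b)]
    refine intervalIntegral.integral_congr fun t ht => ?_
    rw [uIcc_of_le (by norm_num)] at ht
    exact hsplit t ht
  have hS : ∑ k : gaussNodes N, gaussWeight N k * (b / (1 + (k : ℝ) * b)) =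
      (∑ k : gaussNodes N, gaussWeight N k * p.eval (k : ℝ)) +
        b * ∑ k : gaussNodes N, gaussWeight N k * g k := by
    rw [Finset.mul_sum, ← Finset.sum_add_distrib]
    refine Finset.sum_congr rfl fun k _ => ?_
    rw [hsplit _ (Ioo_subset_Icc_self (gaussNode_mem_Ioo k))]
    ring
  have hI0 : 0 ≤ ∫ t in (-1 : ℝ)..1, g t :=
    intervalIntegral.integral_nonneg (by norm_num) hg0
  have hI1 : ∫ t in (-1 : ℝ)..1, g t ≤ 2 * K := by
    refine (intervalIntegral.integral_mono_on (by norm_num) hgint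
      intervalIntegrable_const hg1).trans_eq ?_
    rw [intervalIntegral.integral_const, smul_eq_mul]
    norm_num
  have hS0 : 0 ≤ ∑ k : gaussNodes N, gaussWeight N k * g k :=
    Finset.sum_nonneg fun k _ => mul_nonneg (gaussWeight_pos k).le
      (hg0 _ (Ioo_subset_Icc_self (gaussNode_mem_Ioo k)))
  have hS1 : ∑ k : gaussNodes N, gaussWeight N k * g k ≤ 2 * K := by
    rw [← sum_gaussWeight hN, Finset.sum_mul]
    exact Finset.sum_le_sum fun k _ => mul_le_mul_of_nonneg_left
      (hg1 _ (Ioo_subset_Icc_self (gaussNode_mem_Ioo k))) (gaussWeight_pos k).le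
  -- The polynomial parts cancel; the integral and the quadrature sum of `g` both lie in `[0, 2 K]`.
  rw [hS, hI, ← gauss_exact hp, add_sub_add_left_eq_sub, ← mul_sub, abs_mul]
  calc _ ≤ |b| * (2 * K) :=
        mul_le_mul_of_nonneg_left (abs_le.2 ⟨by linarith, by linarith⟩) (abs_nonneg b)
    _ = _ := by rw [hK]; ring

theorem abs_gauss_phi3_sub_log_le {M δ xhat x : ℝ} (hδ : 0 < δ) (hδ1 : δ < 1) (hxhat : 0 < xhat)
    (hx : x ∈ scaledDomain M δ xhat) {N : ℕ} (hN : 1 ≤ N) :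
    |∑ k : gaussNodes N, gaussWeight N k * phi3 xhat (k : ℝ) x -
      (Real.log x - Real.log xhat)| ≤ δ ^ (2 * N) / (1 - δ) := by
  have hu := abs_div_sub_one_le hx
  have hxpos : 0 < x / xhat := by linarith [hx.2.1]
  have hx0 : x ≠ 0 := by
    rintro rfl
    simp at hxpos
  rw [← Real.log_div hx0 hxhat.ne']
  simp only [phi3]
  obtain ⟨u, hu'⟩ : ∃ u, u = x / xhat - 1 := ⟨_, rfl⟩
  rw [show x / xhat = 1 + u by rw [hu']; ring, add_sub_cancel_left]
  rw [← hu'] at hu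
  obtain ⟨hu1, hu2⟩ := abs_le.1 hu
  have h2u : 0 < 2 + u := by linarith
  set b := u / (2 + u) with hb
  have hbδ : |b| ≤ δ / (2 - δ) := by
    rw [hb, abs_div, abs_of_pos h2u, div_le_div_iff₀ h2u (by linarith)]
    rcases abs_cases u with ⟨h, _⟩ | ⟨h, _⟩ <;> rw [h] <;> nlinarith
  have hb1 : |b| < 1 := hbδ.trans_lt ((div_lt_one (by linarith)).2 (by linarith))
  have h := abs_gauss_error_le hb1 hN
  have hlog : Real.log (1 + b) - Real.log (1 - b) = Real.log (1 + u) := by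
    obtain ⟨h1, h2⟩ := abs_lt.1 hb1
    rw [← Real.log_div (by linarith) (by linarith)]
    congr 1
    rw [div_eq_iff (by linarith), hb]
    field_simp
    ring
  have hterm : ∀ k : gaussNodes N, u / (2 + ((k : ℝ) + 1) * u) = b / (1 + (k : ℝ) * b) := by
    intro k
    have h1 := (one_add_mul_pos hb1 (Ioo_subset_Icc_self (gaussNode_mem_Ioo k))).2
    have h2 : 2 + ((k : ℝ) + 1) * u = (2 + u) * (1 + (k : ℝ) * b) := by
      rw [hb]; field_simp; ring
    rw [h2, ← div_div]
  rw [hlog] at h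
  simp only [hterm]
  refine h.trans ?_
  have hbd : |b| ≤ δ := hbδ.trans ((div_le_iff₀ (by linarith)).2 (by nlinarith))
  have hmul : |b| * (2 - δ) ≤ δ := (le_div_iff₀ (by linarith)).1 hbδ
  rw [div_le_div_iff₀ (by linarith) (by linarith)]
  have hpow : |b| ^ (2 * N) ≤ δ ^ (2 * N) := by gcongr
  -- Since `|b| ≤ δ / (2 - δ)`, this reduces to `δ (3 - 2 δ) ≤ 2 - δ`, that is `0 ≤ 2 (1 - δ)²`.
  have hlin : 2 * |b| * (1 - δ) ≤ 1 - |b| := by nlinarith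
  calc 2 * |b| * |b| ^ (2 * N) * (1 - δ) = |b| ^ (2 * N) * (2 * |b| * (1 - δ)) := by ring
    _ ≤ δ ^ (2 * N) * (1 - |b|) :=
      mul_le_mul hpow hlin (mul_nonneg (by positivity) (by linarith)) (by positivity)

/-! ### Number of points and conclusion -/

theorem pow_div_le_of_pointRate_le {δ ε : ℝ} (hδ : 0 < δ) (hδ1 : δ < 1) (hε : 0 < ε) {n : ℕ}
    (hn : pointRate δ ε ≤ n) : δ ^ n / (1 - δ) ≤ ε := by
  have h1 : 0 < 1 - δ := by linarith
  have hlog : Real.log δ < 0 := Real.log_neg hδ hδ1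
  rw [div_le_iff₀ h1, ← Real.log_le_log_iff (by positivity) (by positivity), Real.log_pow,
    Real.log_mul hε.ne' h1.ne']
  rw [pointRate, ← add_div, div_le_iff_of_neg hlog] at hn
  linarith

/-- The choice `v k = phi3 xhat k x` gives the first inclusion; positivity of the weights makes it
the best choice, which gives the second. -/
theorem approxHyp3_sandwich {D : Set ℝ} {xhat ε : ℝ} {N : ℕ}
    (herr : ∀ x ∈ D, |∑ k : gaussNodes N, gaussWeight N k * phi3 xhat (k : ℝ) x -
      (Real.log x - Real.log xhat)| ≤ ε) :
    hypLog D (-ε) ⊆ approxHyp3 D xhat N ∧ approxHyp3 D xhat N ⊆ hypLog D ε := by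
  constructor
  · rintro ⟨x, ν⟩ ⟨hx, h⟩
    refine ⟨hx, fun k => phi3 xhat (k : ℝ) x, ?_, fun k => ⟨hx, le_rfl⟩⟩
    have := (abs_le.1 (herr x hx)).1
    dsimp only at *
    linarith
  · rintro ⟨x, ν⟩ ⟨hx, v, hv, h⟩
    refine ⟨hx, ?_⟩
    have h1 := (abs_le.1 (herr x hx)).2
    have h2 : ∑ k : gaussNodes N, gaussWeight N k * v k ≤
        ∑ k : gaussNodes N, gaussWeight N k * phi3 xhat (k : ℝ) x :=
      Finset.sum_le_sum fun k _ => mul_le_mul_of_nonneg_left (h k).2 (gaussWeight_pos k).le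
    dsimp only at *
    linarith

/-- With `max 1 ⌈r / 2⌉` points the quadrature is accurate to within `ε`, where `r` is the rate. -/
theorem exists_number_of_points {δ ε : ℝ} (hδ : 0 < δ) (hδ1 : δ < 1) (hε : 0 < ε) :
    ∃ N₀ : ℕ, 1 ≤ N₀ ∧ (N₀ : ℝ) ≤ max 1 (pointRate δ ε) ∧
      ∀ N : ℕ, N₀ ≤ N → ∀ M : ℝ, 1 < M → ∀ xhat ∈ Icc (1 / M) M,
        hypLog (scaledDomain M δ xhat) (-ε) ⊆ approxHyp3 (scaledDomain M δ xhat) xhat N ∧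
          approxHyp3 (scaledDomain M δ xhat) xhat N ⊆ hypLog (scaledDomain M δ xhat) ε := by
  refine ⟨max 1 ⌈pointRate δ ε / 2⌉₊, le_max_left _ _, ?_, fun N hN M hM xhat hxhat => ?_⟩
  · rcases le_or_gt (pointRate δ ε) 2 with hr | hr
    · have : ⌈pointRate δ ε / 2⌉₊ ≤ 1 := Nat.ceil_le.2 (by push_cast; linarith)
      rw [max_eq_left this, Nat.cast_one]
      exact le_max_left _ _
    · have h := Nat.ceil_lt_add_one (a := pointRate δ ε / 2) (by linarith)
      rw [Nat.cast_max, Nat.cast_one]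
      exact max_le_max le_rfl (by linarith)
  · refine approxHyp3_sandwich fun x hx => ?_
    refine (abs_gauss_phi3_sub_log_le hδ hδ1 (xhat_pos hM hxhat) hx
      ((le_max_left _ _).trans hN)).trans (pow_div_le_of_pointRate_le hδ hδ1 hε ?_)
    have h1 : pointRate δ ε / 2 ≤ N :=
      (Nat.le_ceil _).trans (Nat.cast_le.2 ((le_max_right _ _).trans hN))
    push_cast
    linarith

end LogSOC

theorem mainTheorem4 :
    -- the parameters `ρ` and `L`
    (∀ δ : ℝ, 0 < δ → δ < 1 → ∀ ρ L : ℝ, ρ = (2 - δ) / δ →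
      L = ((2 - δ) / δ - ρ / 2 - ρ⁻¹ / 2)⁻¹ →
        1 < ρ ∧ 0 < L ∧
        ∀ M : ℝ, 1 < M → ∀ xhat ∈ Set.Icc (1 / M) M,
          ∀ x ∈ LogSOC.scaledDomain M δ xhat, ∀ θ ∈ Set.Icc 0 (2 * Real.pi),
            (2 + (LogSOC.bernsteinPoint ρ θ + 1) * ((x : ℂ) / (xhat : ℂ) - 1) ≠ 0) ∧
            ‖LogSOC.phi3 (xhat : ℂ) (LogSOC.bernsteinPoint ρ θ) (x : ℂ)‖ ≤ L) ∧
    -- the explicit form of the approximation, with its numbers of variables and SOC constraints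
    (∀ N : ℕ, (LogSOC.gaussNodes N).card = N ∧
      ∀ δ : ℝ, 0 < δ → δ < 1 → ∀ M : ℝ, 1 < M → ∀ xhat ∈ Set.Icc (1 / M) M,
        LogSOC.approxHyp3 (LogSOC.scaledDomain M δ xhat) xhat N =
          LogSOC.socForm3 (LogSOC.scaledDomain M δ xhat) xhat N ∧
        LogSOC.HasSOCRepresentation
          (LogSOC.approxHyp3 (LogSOC.scaledDomain M δ xhat) xhat N) (N + 2) (3 * N + 5)) ∧
    -- the number of points, variables and SOC constraints that achieves accuracy `ε`
    ∃ C : ℝ, 0 < C ∧ ∀ δ ε : ℝ, 0 < δ → δ < 1 → 0 < ε →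
      ∃ N₀ : ℕ, 1 ≤ N₀ ∧ (N₀ : ℝ) ≤ max 1 (C * LogSOC.pointRate δ ε) ∧
        (((N₀ + 2) + (3 * N₀ + 5) : ℕ) : ℝ) ≤ C * max 1 (LogSOC.pointRate δ ε) ∧
        ∀ N : ℕ, N₀ ≤ N → ∀ M : ℝ, 1 < M → ∀ xhat ∈ Set.Icc (1 / M) M,
          LogSOC.hypLog (LogSOC.scaledDomain M δ xhat) (-ε) ⊆
              LogSOC.approxHyp3 (LogSOC.scaledDomain M δ xhat) xhat N ∧
            LogSOC.approxHyp3 (LogSOC.scaledDomain M δ xhat) xhat N ⊆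
              LogSOC.hypLog (LogSOC.scaledDomain M δ xhat) ε := by
  -- The constant 11 comes from `4 N₀ + 7 ≤ 11 * max 1 r`, given `N₀ ≤ max 1 r`, where `r` is the
  -- rate.
  refine ⟨fun δ hδ hδ1 ρ L hρ hL => ?_, fun N => ⟨LogSOC.card_gaussNodes N, ?_⟩,
    11, by norm_num, fun δ ε hδ hδ1 hε => ?_⟩
  · obtain ⟨h1, h2, h3⟩ := LogSOC.phi3_bernstein_bound hδ hδ1 hρ hL
    exact ⟨h1, h2, fun M _ xhat _ x hx θ _ => h3 M xhat x hx θ⟩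
  · intro δ _ hδ1 M _ xhat _
    have h := LogSOC.approxHyp3_eq_socForm3 (M := M) (xhat := xhat) hδ1 N
    exact ⟨h, h ▸ LogSOC.hasSOCRepresentation_socForm3 M δ xhat N⟩
  · obtain ⟨N₀, h1, h2, h3⟩ := LogSOC.exists_number_of_points hδ hδ1 hε
    refine ⟨N₀, h1, ?_, ?_, h3⟩
    · rcases le_max_iff.1 h2 with h | h
      · exact le_max_of_le_left h
      · have h4 : (1 : ℝ) ≤ N₀ := Nat.one_le_cast.2 h1
        exact le_max_of_le_right (by linarith)
    · push_cast
      linarith [le_max_left 1 (LogSOC.pointRate δ ε)]
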